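/- For linearly independent $A,B\in\mathbb R^4$ let $AB$ also denote the point of the real Grassmannian $\mathrm{Gr}_{\mathbb R}(2,4)$ given by their span, and for $a,b,c,d\in\mathbb R^4$ let $\langle a\,b\,c\,d\rangle$ be the determinant of the $4\times4$ matrix with rows $a,b,c,d$. Let $Z$ be a real $4\times 4$ matrix with positive determinant (for instance a totally positive matrix, or the identity), with rows $Z_1,\dots,Z_4$, and write $\langle AB\,ij\rangle=\langle A\,B\,Z_i\,Z_j\rangle$. The two-loop four-point Amplituhedron $\mathcal A^{(2)}_4\subset \mathrm{Gr}_{\mathbb R}(2,4)^2$ is the Euclidean closure of the set of all pairs of points that can be represented as $(A_1B_1,A_2B_2)$ such that 1. $\langle A_\ell B_\ell 12\rangle,\ \langle A_\ell B_\ell 23\rangle,\ \langle A_\ell B_\ell 34\rangle,\ \langle A_\ell B_\ell 14\rangle>0$ for $\ell=1,2$; 2. for $\ell=1,2$ the sequence $(\langle A_\ell B_\ell 12\rangle,\langle A_\ell B_\ell 13\rangle,\langle A_\ell B_\ell 14\rangle)$ has exactly two sign flips, ignoring zeros; 3. $\langle A_1\,B_1\,A_2\,B_2\rangle>0$. **Theorem.**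 The Euclidean interior $\mathrm{int}(\mathcal A^{(2)}_4)$ of $\mathcal A^{(2)}_4$ in $\mathrm{Gr}_{\mathbb R}(2,4)^2$ is connected (in particular non-empty), and its fundamental group, at any base point, is free of rank one (that is, isomorphic to $\mathbb Z$). -/

import Mathlib

noncomputable section

namespace LoopAmplituhedron

/-- Real `k × n` matrices of rank `k` (linearly independent rows), with the subspace topology. -/
abbrev FullRank (k n : ℕ) : Type :=
  {M : Matrix (Fin k) (Fin n) ℝ // LinearIndependent ℝ M.row}

/-- The real Grassmannian `Gr(k, n)` of `k`-dimensional linear subspaces of `ℝⁿ`. -/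
def Gr (k n : ℕ) : Type :=
  {V : Submodule ℝ (Fin n → ℝ) // Module.finrank ℝ V = k}

/-- The point of `Gr(k, n)` represented by a full-rank matrix: its row space. -/
def rowSpace {k n : ℕ} (M : FullRank k n) : Gr k n :=
  ⟨Submodule.span ℝ (Set.range M.1.row), by
    simpa using finrank_span_eq_card M.2⟩

/-- The Euclidean topology on the Grassmannian: the quotient topology of the space of matrix
representatives. -/
instance (k n : ℕ) : TopologicalSpace (Gr k n) :=
  TopologicalSpace.coinduced rowSpace inferInstance

/-- The determinant `⟨a b c d⟩` of the `4 × 4` matrix with rows `a, b, c, d`. -/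
def bracket (a b c d : Fin 4 → ℝ) : ℝ :=
  (Matrix.of ![a, b, c, d]).det

/-- The twistor coordinate `⟨X Y⟩` of two `2 × 4` matrices: the determinant of the `4 × 4` matrix
obtained by stacking `X` on top of `Y`. -/
def stack (X Y : Matrix (Fin 2) (Fin 4) ℝ) : ℝ :=
  bracket (X 0) (X 1) (Y 0) (Y 1)

/-- The twistor coordinate `⟨A B i j⟩`, where `X` has rows `A, B`, and `i, j` stand for the
corresponding rows of `Z`. -/
def twistor {n : ℕ} (Z : Matrix (Fin n) (Fin 4) ℝ) (X : Matrix (Fin 2) (Fin 4) ℝ)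
    (i j : Fin n) : ℝ :=
  bracket (X 0) (X 1) (Z i) (Z j)

/-- The number of sign flips of a finite real sequence, ignoring zeros: the number of pairs of
entries of opposite strict sign that are separated only by zeros. -/
def signFlips {m : ℕ} (s : Fin m → ℝ) : ℕ :=
  Set.ncard {p : Fin m × Fin m |
    p.1 < p.2 ∧ s p.1 * s p.2 < 0 ∧ ∀ k, p.1 < k → k < p.2 → s k = 0}

/-- The one-loop conditions on a matrix `X` with rows `A, B`, for `n = m + 1` points (the indices
`1, …, n` are `0, …, m` here): `⟨A B i i+1⟩ > 0`, `⟨A B 1 n⟩ > 0`, and the sequence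
`⟨A B 1 2⟩, …, ⟨A B 1 n⟩` has exactly two sign flips. -/
structure OneLoop {m : ℕ} (Z : Matrix (Fin (m + 1)) (Fin 4) ℝ)
    (X : Matrix (Fin 2) (Fin 4) ℝ) : Prop where
  consecutive : ∀ i : Fin m, 0 < twistor Z X i.castSucc i.succ
  first_last : 0 < twistor Z X 0 (Fin.last m)
  flips : signFlips (fun j : Fin m => twistor Z X 0 j.succ) = 2

/-- The semialgebraic subset of `Gr(2, 4)^L` of all points with matrix representatives that satisfy
the one-loop conditions and the mutual positivity conditions. -/
def openConditions (L : ℕ) {m : ℕ} (Z : Matrix (Fin (m + 1)) (Fin 4) ℝ) :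
    Set (Fin L → Gr 2 4) :=
  {P | ∃ X : Fin L → FullRank 2 4,
    (∀ l, rowSpace (X l) = P l) ∧
    (∀ l, OneLoop Z (X l).1) ∧
    ∀ l l', l < l' → 0 < stack (X l).1 (X l').1}

/-- The `(m + 1)`-point `L`-loop Amplituhedron: the Euclidean closure of this set in
`Gr(2, 4)^L` (with the product topology). -/
def amplituhedron (L : ℕ) {m : ℕ} (Z : Matrix (Fin (m + 1)) (Fin 4) ℝ) :
    Set (Fin L → Gr 2 4) :=
  closure (openConditions L Z)

end LoopAmplituhedron

end

/-!
Write the matrix representatives `X` of a plane as `X = Y * Z`. Since `det Z > 0`, the brackets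
`⟨A B i j⟩` are, up to sign and the factor `det Z`, the complementary minors of `Y`; by the
three-term Plücker relation the one-loop conditions say exactly that all six minors of `Y` are
positive (`oneLoop_mul_iff`). Such planes lie in the affine chart of `Gr(2, 4)` where the minor of
the columns `0, 2` does not vanish, and there they form the positive orthant of `ℝ⁴`. For two
planes with coordinates `u` and `v`, mutual positivity reads `q (u - v) < 0`, where `q w = w₀ w₃ +
w₁ w₂` has signature `(2, 2)` (`stack_chart`). So the set of pairs satisfying the conditions is
homeomorphic to `{(u, v) | u, v > 0, q (u - v) < 0}` (`openConditionsHomeomorph`).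

Passing to the interior of the closure adds no points (`interior_amplituhedron`). On the closure
the products of pairs of minors, and the suitably normalised stacked determinant, are nonnegative.
Each minor, and the stacked determinant as a function of either matrix, is an indefinite quadratic
form, hence by the parallelogram law takes both signs near any of its zeros; so at an interior
point none of them vanishes. Since the row space map is an open quotient map, all this can be
tested on representatives.

Finally, the map sending `(u, v)` to the component of `u - v` in a negative definite plane of `q`
is a homotopy equivalence onto the punctured plane: it has an explicit section, and the
straight-line homotopy keeps `u, v` positive and the negative definite component of `u - v` fixed
while it shrinks the positive definite one (`positiveRegionHomotopyEquiv`). The fundamental group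
of the punctured plane is `ℤ` because the exponential map is its universal covering, with deck
group `2πi ℤ`.
-/

noncomputable section

namespace LoopAmplituhedron

open Topology Matrix

/-! ### Homotopy equivalences and the punctured plane -/

theorem pathConnectedSpace_of_homotopyEquiv {X Y : Type*} [TopologicalSpace X]
    [TopologicalSpace Y] (e : ContinuousMap.HomotopyEquiv X Y) [PathConnectedSpace Y] :
    PathConnectedSpace X := by
  obtain ⟨H⟩ := e.left_inv
  have hH (x : X) : Joined (e.symm (e x)) x := ⟨H.evalAt x⟩
  refine ⟨(PathConnectedSpace.nonempty (X := Y)).map e.symm, fun x y => ?_⟩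
  exact (hH x).symm.trans
    (((PathConnectedSpace.joined (e x) (e y)).map e.symm.continuous).trans (hH y))

theorem nonempty_fundamentalGroup_mulEquiv {X Y : Type} [TopologicalSpace X]
    [TopologicalSpace Y] (e : ContinuousMap.HomotopyEquiv X Y) (x : X) :
    Nonempty (FundamentalGroup X x ≃* FundamentalGroup Y (e x)) :=
  ⟨(FundamentalGroupoidFunctor.equivOfHomotopyEquiv e).fullyFaithfulFunctor.mulEquivEnd
    (FundamentalGroupoid.mk x)⟩

/-- The exponential map is a simply connected covering of the punctured plane with deck group
`2πi ℤ`. -/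
theorem nonempty_fundamentalGroup_compl_zero_mulEquiv (z : {z : ℂ // z ≠ 0}) :
    Nonempty (FundamentalGroup {z : ℂ // z ≠ 0} z ≃* FreeGroup Unit) := by
  have hexp := Complex.isAddQuotientCoveringMap_exp
  set g : ℂ := 2 * Real.pi * Complex.I
  have hg : g ≠ 0 := by simp [g]
  let e : (fun z : ℂ ↦ (⟨_, z.exp_ne_zero⟩ : {z : ℂ // z ≠ 0})) ⁻¹' {z} :=
    ⟨Complex.log z.1, Subtype.ext (Complex.exp_log z.2)⟩
  let f : ℤ →+ AddSubgroup.zmultiples g :=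
    zmultiplesHom _ ⟨g, AddSubgroup.mem_zmultiples g⟩
  have hf : Function.Bijective f := by
    constructor
    · intro m n h
      have h' : m • g = n • g := congrArg Subtype.val h
      simpa [hg] using h'
    · rintro ⟨_, n, rfl⟩
      exact ⟨n, rfl⟩
  exact ⟨(hexp.fundamentalGroupEquiv e).trans
    ((AddEquiv.ofBijective f hf).toMultiplicative.trans MulOpposite.opMulEquiv).symm |>.trans
      FreeGroup.mulEquivIntOfUnique.symm⟩

theorem pathConnectedSpace_compl_zero : PathConnectedSpace {z : ℂ // z ≠ 0} :=
  isPathConnected_iff_pathConnectedSpace.1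
    (isPathConnected_compl_singleton_of_one_lt_rank (by simp [Complex.rank_real_complex]) (0 : ℂ))

/-! ### The row space map is an open quotient map -/

theorem linearIndependent_row_mul {k n : ℕ} {g : Matrix (Fin k) (Fin k) ℝ} (hg : IsUnit g)
    {M : Matrix (Fin k) (Fin n) ℝ} (hM : LinearIndependent ℝ M.row) :
    LinearIndependent ℝ (g * M).row := by
  rw [← Matrix.vecMul_injective_iff] at hM ⊢
  have hg' := Matrix.vecMul_injective_of_isUnit hg
  intro v w h
  simp only [← Matrix.vecMul_vecMul] at h
  exact hg' (hM h)

/-- Left multiplication of a full-rank matrix by an invertible square matrix. -/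
def unitMul {k n : ℕ} (g : (Matrix (Fin k) (Fin k) ℝ)ˣ) (M : FullRank k n) : FullRank k n :=
  ⟨g.1 * M.1, linearIndependent_row_mul g.isUnit M.2⟩

theorem continuous_unitMul {k n : ℕ} (g : (Matrix (Fin k) (Fin k) ℝ)ˣ) :
    Continuous (unitMul g : FullRank k n → FullRank k n) :=
  Continuous.subtype_mk (continuous_const.matrix_mul continuous_subtype_val) _

theorem exists_mul_of_span_le {k n : ℕ} {M N : Matrix (Fin k) (Fin n) ℝ}
    (h : Submodule.span ℝ (Set.range M.row) ≤ Submodule.span ℝ (Set.range N.row)) :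
    ∃ g : Matrix (Fin k) (Fin k) ℝ, M = g * N := by
  have hM (i : Fin k) : ∃ c : Fin k → ℝ, ∑ j, c j • N.row j = M.row i :=
    Submodule.mem_span_range_iff_exists_fun ℝ |>.1 (h (Submodule.subset_span ⟨i, rfl⟩))
  choose g hg using hM
  refine ⟨Matrix.of g, ?_⟩
  ext i j
  have := congrFun (hg i) j
  simpa [Matrix.mul_apply, Matrix.row] using this.symm

theorem span_mul_le {k n : ℕ} (g : Matrix (Fin k) (Fin k) ℝ) (N : Matrix (Fin k) (Fin n) ℝ) :
    Submodule.span ℝ (Set.range (g * N).row) ≤ Submodule.span ℝ (Set.range N.row) := by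
  rw [Submodule.span_le]
  rintro _ ⟨i, rfl⟩
  refine (Submodule.mem_span_range_iff_exists_fun ℝ).2 ⟨g i, ?_⟩
  ext j
  simp [Matrix.mul_apply, Matrix.row]

theorem rowSpace_unitMul {k n : ℕ} (g : (Matrix (Fin k) (Fin k) ℝ)ˣ) (M : FullRank k n) :
    rowSpace (unitMul g M) = rowSpace M := by
  refine Subtype.ext (le_antisymm (span_mul_le g.1 M.1) ?_)
  have h : g⁻¹.1 * (g.1 * M.1) = M.1 := by
    rw [← Matrix.mul_assoc, ← Units.val_mul]; simp
  have hle := span_mul_le g⁻¹.1 (g.1 * M.1)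
  rwa [h] at hle

/-- Two full-rank matrices have the same row space exactly when they differ by an invertible change
of rows. -/
theorem rowSpace_eq_iff {k n : ℕ} {M N : FullRank k n} :
    rowSpace M = rowSpace N ↔ ∃ g : (Matrix (Fin k) (Fin k) ℝ)ˣ, M = unitMul g N := by
  refine ⟨fun h => ?_, fun ⟨g, hg⟩ => hg ▸ rowSpace_unitMul g N⟩
  have h' := congrArg Subtype.val h
  obtain ⟨g, hg⟩ := exists_mul_of_span_le h'.le
  obtain ⟨g', hg'⟩ := exists_mul_of_span_le h'.ge
  have hN := Matrix.vecMul_injective_iff.2 N.2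
  have hone : g' * g = 1 := by
    refine funext fun i => hN ?_
    have hmul : g' * g * N.1 = (1 : Matrix (Fin k) (Fin k) ℝ) * N.1 := by
      rw [Matrix.mul_assoc, ← hg, ← hg', Matrix.one_mul]
    exact congrFun hmul i
  exact ⟨⟨g, g', mul_eq_one_comm.1 hone, hone⟩, Subtype.ext hg⟩

theorem surjective_rowSpace {k n : ℕ} : Function.Surjective (rowSpace : FullRank k n → Gr k n) := by
  rintro ⟨V, hV⟩
  let b := Module.finBasisOfFinrankEq ℝ V hV
  have hb : LinearIndependent ℝ (fun i => (b i : Fin n → ℝ)) :=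
    b.linearIndependent.map' V.subtype V.ker_subtype
  refine ⟨⟨Matrix.of fun i => (b i : Fin n → ℝ), hb⟩, Subtype.ext ?_⟩
  have h := congrArg (Submodule.map V.subtype) b.span_eq
  rw [Submodule.map_span, ← Set.range_comp, Submodule.map_top, Submodule.range_subtype] at h
  exact h

/-- The row space map is open: the saturation of an open set is the union of its translates under
the general linear group. -/
theorem isOpenQuotientMap_rowSpace {k n : ℕ} :
    IsOpenQuotientMap (rowSpace : FullRank k n → Gr k n) := by
  refine ⟨surjective_rowSpace, continuous_coinduced_rng, fun U hU => ?_⟩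
  refine isOpen_coinduced.2 ?_
  have : rowSpace ⁻¹' (rowSpace '' U) =
      ⋃ g : (Matrix (Fin k) (Fin k) ℝ)ˣ, (unitMul g : FullRank k n → FullRank k n) ⁻¹' U := by
    ext N
    simp only [Set.mem_preimage, Set.mem_image, Set.mem_iUnion]
    constructor
    · rintro ⟨M, hM, h⟩
      obtain ⟨g, rfl⟩ := rowSpace_eq_iff.1 h
      exact ⟨g, hM⟩
    · rintro ⟨g, hg⟩
      exact ⟨_, hg, rowSpace_unitMul g N⟩
  rw [this]
  exact isOpen_iUnion fun g => hU.preimage (continuous_unitMul g)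

/-! ### Minors and the chart -/

/-- The `2 × 2` minor of a `2 × 4` matrix in the columns `i` and `j`. -/
def minor (Y : Matrix (Fin 2) (Fin 4) ℝ) (i j : Fin 4) : ℝ :=
  Y 0 i * Y 1 j - Y 0 j * Y 1 i

theorem bracket_vecMul (Z : Matrix (Fin 4) (Fin 4) ℝ) (a b c d : Fin 4 → ℝ) :
    bracket (a ᵥ* Z) (b ᵥ* Z) (c ᵥ* Z) (d ᵥ* Z) = bracket a b c d * Z.det := by
  rw [bracket, bracket, ← Matrix.det_mul]
  congr 1
  ext i j
  fin_cases i <;> rfl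

theorem stack_mul (Z : Matrix (Fin 4) (Fin 4) ℝ) (Y Y' : Matrix (Fin 2) (Fin 4) ℝ) :
    stack (Y * Z) (Y' * Z) = stack Y Y' * Z.det :=
  bracket_vecMul Z (Y 0) (Y 1) (Y' 0) (Y' 1)

theorem twistor_mul (Z : Matrix (Fin 4) (Fin 4) ℝ) (Y : Matrix (Fin 2) (Fin 4) ℝ) (i j : Fin 4) :
    twistor Z (Y * Z) i j = bracket (Y 0) (Y 1) (Pi.single i 1) (Pi.single j 1) * Z.det := by
  rw [← bracket_vecMul, Matrix.single_one_vecMul, Matrix.single_one_vecMul]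
  rfl

/-- Laplace expansion along the first two rows. -/
theorem bracket_eq (a b c d : Fin 4 → ℝ) :
    bracket a b c d =
      (a 0 * b 1 - a 1 * b 0) * (c 2 * d 3 - c 3 * d 2)
      - (a 0 * b 2 - a 2 * b 0) * (c 1 * d 3 - c 3 * d 1)
      + (a 0 * b 3 - a 3 * b 0) * (c 1 * d 2 - c 2 * d 1)
      + (a 1 * b 2 - a 2 * b 1) * (c 0 * d 3 - c 3 * d 0)
      - (a 1 * b 3 - a 3 * b 1) * (c 0 * d 2 - c 2 * d 0)
      + (a 2 * b 3 - a 3 * b 2) * (c 0 * d 1 - c 1 * d 0) := by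
  simp [bracket, Matrix.det_succ_row_zero, Fin.sum_univ_succ, Fin.succAbove]
  ring

theorem stack_eq (Y Y' : Matrix (Fin 2) (Fin 4) ℝ) :
    stack Y Y' = minor Y 0 1 * minor Y' 2 3 - minor Y 0 2 * minor Y' 1 3
      + minor Y 0 3 * minor Y' 1 2 + minor Y 1 2 * minor Y' 0 3
      - minor Y 1 3 * minor Y' 0 2 + minor Y 2 3 * minor Y' 0 1 :=
  bracket_eq _ _ _ _

/-- Between two positive entries, two sign flips mean a negative middle entry. -/
theorem signFlips_eq_two_iff {s : Fin 3 → ℝ} (h0 : 0 < s 0) (h2 : 0 < s 2) :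
    signFlips s = 2 ↔ s 1 < 0 := by
  have h02 : ¬ s 0 * s 2 < 0 := (mul_pos h0 h2).not_gt
  rcases lt_or_ge (s 1) 0 with h1 | h1
  · have hset : {p : Fin 3 × Fin 3 |
        p.1 < p.2 ∧ s p.1 * s p.2 < 0 ∧ ∀ k, p.1 < k → k < p.2 → s k = 0} =
        {((0 : Fin 3), (1 : Fin 3)), ((1 : Fin 3), (2 : Fin 3))} := by
      have h01 := mul_neg_of_pos_of_neg h0 h1
      have h12 := mul_neg_of_neg_of_pos h1 h2
      ext ⟨i, j⟩
      fin_cases i <;> fin_cases j <;> simp [h02, h01, h12, Fin.forall_fin_succ]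
    rw [signFlips, hset, Set.ncard_pair (by simp)]
    simpa using h1
  · have hset : {p : Fin 3 × Fin 3 |
        p.1 < p.2 ∧ s p.1 * s p.2 < 0 ∧ ∀ k, p.1 < k → k < p.2 → s k = 0} = ∅ := by
      have h01 := (mul_nonneg h0.le h1).not_gt
      have h12 := (mul_nonneg h1 h2.le).not_gt
      ext ⟨i, j⟩
      fin_cases i <;> fin_cases j <;> simp [h02, h01, h12]
    rw [signFlips, hset]
    simpa using h1

/-- The one-loop conditions for four points are total positivity of the representative in the basis
given by the rows of `Z`. -/
theorem oneLoop_mul_iff {Z : Matrix (Fin 4) (Fin 4) ℝ} (hZ : 0 < Z.det)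
    (Y : Matrix (Fin 2) (Fin 4) ℝ) :
    OneLoop Z (Y * Z) ↔ ∀ i j, i < j → 0 < minor Y i j := by
  have h01 : twistor Z (Y * Z) 0 1 = minor Y 2 3 * Z.det := by
    rw [twistor_mul, bracket_eq]; simp [minor]
  have h12 : twistor Z (Y * Z) 1 2 = minor Y 0 3 * Z.det := by
    rw [twistor_mul, bracket_eq]; simp [minor]
  have h23 : twistor Z (Y * Z) 2 3 = minor Y 0 1 * Z.det := by
    rw [twistor_mul, bracket_eq]; simp [minor]
  have h03 : twistor Z (Y * Z) 0 3 = minor Y 1 2 * Z.det := by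
    rw [twistor_mul, bracket_eq]; simp [minor]
  have h02 : twistor Z (Y * Z) 0 2 = -minor Y 1 3 * Z.det := by
    rw [twistor_mul, bracket_eq]; simp [minor]
  have hplucker : minor Y 0 2 * minor Y 1 3 =
      minor Y 0 1 * minor Y 2 3 + minor Y 0 3 * minor Y 1 2 := by
    simp only [minor]; ring
  constructor
  · rintro ⟨hc, hl, hf⟩
    have c0 : 0 < twistor Z (Y * Z) 0 1 := hc 0
    have c1 : 0 < twistor Z (Y * Z) 1 2 := hc 1
    have c2 : 0 < twistor Z (Y * Z) 2 3 := hc 2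
    have c3 : 0 < twistor Z (Y * Z) 0 3 := hl
    have c4 : twistor Z (Y * Z) 0 2 < 0 := (signFlips_eq_two_iff c0 c3).1 hf
    rw [h01] at c0; rw [h12] at c1; rw [h23] at c2; rw [h03] at c3; rw [h02] at c4
    replace c0 := pos_of_mul_pos_left c0 hZ.le
    replace c1 := pos_of_mul_pos_left c1 hZ.le
    replace c2 := pos_of_mul_pos_left c2 hZ.le
    replace c3 := pos_of_mul_pos_left c3 hZ.le
    have c4 : 0 < minor Y 1 3 := by
      have : 0 < minor Y 1 3 * Z.det := by linarith
      exact pos_of_mul_pos_left this hZ.le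
    -- The sixth minor is not constrained directly; the Plücker relation gives its sign.
    have c5 : 0 < minor Y 0 2 := by
      refine pos_of_mul_pos_left (b := minor Y 1 3) ?_ c4.le
      rw [hplucker]; positivity
    intro i j hij
    fin_cases i <;> fin_cases j <;> first | exact absurd hij (by decide) | assumption
  · intro h
    have c0 : 0 < twistor Z (Y * Z) 0 1 := h01 ▸ mul_pos (h 2 3 (by decide)) hZ
    have c1 : 0 < twistor Z (Y * Z) 1 2 := h12 ▸ mul_pos (h 0 3 (by decide)) hZ
    have c2 : 0 < twistor Z (Y * Z) 2 3 := h23 ▸ mul_pos (h 0 1 (by decide)) hZ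
    have c3 : 0 < twistor Z (Y * Z) 0 3 := h03 ▸ mul_pos (h 1 2 (by decide)) hZ
    have c4 : twistor Z (Y * Z) 0 2 < 0 := by
      have := mul_pos (h 1 3 (by decide)) hZ
      rw [h02]; linarith
    refine ⟨fun i => ?_, c3, (signFlips_eq_two_iff c0 c3).2 c4⟩
    fin_cases i
    exacts [c0, c1, c2]

theorem minor_mul (g : Matrix (Fin 2) (Fin 2) ℝ) (Y : Matrix (Fin 2) (Fin 4) ℝ) (i j : Fin 4) :
    minor (g * Y) i j = g.det * minor Y i j := by
  simp only [minor, Matrix.mul_apply, Fin.sum_univ_two, Matrix.det_fin_two]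
  ring

theorem stack_mul_mul (g g' : Matrix (Fin 2) (Fin 2) ℝ) (Y Y' : Matrix (Fin 2) (Fin 4) ℝ) :
    stack (g * Y) (g' * Y') = g.det * g'.det * stack Y Y' := by
  simp only [stack_eq, minor_mul]
  ring

/-- A `2 × 4` matrix with independent rows has a nonvanishing maximal minor. -/
theorem exists_minor_ne_zero {Y : Matrix (Fin 2) (Fin 4) ℝ} (hY : LinearIndependent ℝ Y.row) :
    ∃ i j, i < j ∧ minor Y i j ≠ 0 := by
  by_contra! h
  have hall (i j : Fin 4) : minor Y i j = 0 := by
    rcases lt_trichotomy i j with hij | rfl | hij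
    · exact h i j hij
    · simp [minor]
    · have := h j i hij
      simp only [minor] at this ⊢
      linarith
  have hrow : ![Y 0, Y 1] = Y.row := by
    ext i j
    fin_cases i <;> rfl
  have hpair := LinearIndependent.pair_iff.1 (hrow ▸ hY)
  have hzero (k : Fin 4) : Y 0 k = 0 := by
    have := hpair (Y 1 k) (-Y 0 k) (by
      ext j
      have := hall j k
      simp only [minor] at this
      simp only [Pi.add_apply, Pi.smul_apply, smul_eq_mul, Pi.zero_apply]
      linarith)
    simpa using this.2
  have := hpair 1 0 (by
    ext j
    simp [hzero j])
  simp at this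

/-- The chart of `Gr(2, 4)` centred at the coordinate plane of the columns `0` and `2`, with signs
chosen so that the four entries are quotients of minors. -/
def chart (u : Fin 4 → ℝ) : Matrix (Fin 2) (Fin 4) ℝ :=
  !![1, u 0, 0, -u 1; 0, u 2, 1, u 3]

/-- The inverse of `chart` on matrices with nonvanishing minor in the columns `0` and `2`. -/
def coord (Y : Matrix (Fin 2) (Fin 4) ℝ) : Fin 4 → ℝ :=
  ![minor Y 1 2 / minor Y 0 2, minor Y 2 3 / minor Y 0 2, minor Y 0 1 / minor Y 0 2,
    minor Y 0 3 / minor Y 0 2]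

/-- The quadratic form of signature `(2, 2)` that describes mutual positivity in the chart. -/
def pairing (w : Fin 4 → ℝ) : ℝ := w 0 * w 3 + w 1 * w 2

theorem coord_chart (u : Fin 4 → ℝ) : coord (chart u) = u := by
  ext i
  fin_cases i <;> simp [coord, chart, minor]

theorem coord_mul {g : Matrix (Fin 2) (Fin 2) ℝ} (hg : g.det ≠ 0) (Y : Matrix (Fin 2) (Fin 4) ℝ) :
    coord (g * Y) = coord Y := by
  simp only [coord, minor_mul, mul_div_mul_left _ _ hg]

/-- The change of rows that brings `Y` into the chart is given by its columns `0` and `2`. -/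
theorem exists_mul_chart_coord {Y : Matrix (Fin 2) (Fin 4) ℝ} (hY : minor Y 0 2 ≠ 0) :
    ∃ g : Matrix (Fin 2) (Fin 2) ℝ, g.det = minor Y 0 2 ∧ Y = g * chart (coord Y) := by
  refine ⟨!![Y 0 0, Y 0 2; Y 1 0, Y 1 2], by simp [Matrix.det_fin_two, minor], ?_⟩
  ext i j
  fin_cases i <;> fin_cases j <;>
    simp [Matrix.mul_apply, Fin.sum_univ_two, chart, coord] <;> field_simp <;>
    simp only [minor] <;> ring

theorem stack_chart (u v : Fin 4 → ℝ) : stack (chart u) (chart v) = -pairing (u - v) := by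
  simp [stack_eq, chart, minor, pairing]
  ring

theorem minor_chart_pos_iff (u : Fin 4 → ℝ) :
    (∀ i j, i < j → 0 < minor (chart u) i j) ↔ ∀ k, 0 < u k := by
  have h01 : minor (chart u) 0 1 = u 2 := by simp [minor, chart]
  have h02 : minor (chart u) 0 2 = 1 := by simp [minor, chart]
  have h03 : minor (chart u) 0 3 = u 3 := by simp [minor, chart]
  have h12 : minor (chart u) 1 2 = u 0 := by simp [minor, chart]
  have h23 : minor (chart u) 2 3 = u 1 := by simp [minor, chart]
  have h13 : minor (chart u) 1 3 = u 0 * u 3 + u 1 * u 2 := by simp [minor, chart]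
  constructor
  · intro h k
    fin_cases k
    · exact h12 ▸ h 1 2 (by decide)
    · exact h23 ▸ h 2 3 (by decide)
    · exact h01 ▸ h 0 1 (by decide)
    · exact h03 ▸ h 0 3 (by decide)
  · intro h i j hij
    have h0 := h 0
    have h1 := h 1
    have h2 := h 2
    have h3 := h 3
    fin_cases i <;> fin_cases j <;> first
      | exact absurd hij (by decide)
      | (simp only [Fin.zero_eta, Fin.mk_one, Fin.reduceFinMk, h01, h02, h03, h12, h23, h13]
         positivity)

/-! ### The two-loop conditions on representatives -/

/-- The conditions of the two-loop Amplituhedron in terms of products that do not depend on the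
choice of matrix representatives: the minors of each matrix have one common strict sign, and the
stacked determinant is positive when both signs are normalised to be positive. -/
def StrictSigns (Y : Fin 2 → Matrix (Fin 2) (Fin 4) ℝ) : Prop :=
  (∀ l i j, i < j → ∀ k m, k < m → 0 < minor (Y l) i j * minor (Y l) k m) ∧
    0 < minor (Y 0) 0 2 * minor (Y 1) 0 2 * stack (Y 0) (Y 1)

/-- The weak form of `StrictSigns`, a closed condition. -/
def WeakSigns (Y : Fin 2 → Matrix (Fin 2) (Fin 4) ℝ) : Prop :=
  (∀ l i j, i < j → ∀ k m, k < m → 0 ≤ minor (Y l) i j * minor (Y l) k m) ∧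
    0 ≤ minor (Y 0) 0 2 * minor (Y 1) 0 2 * stack (Y 0) (Y 1)

theorem StrictSigns.weakSigns {Y : Fin 2 → Matrix (Fin 2) (Fin 4) ℝ} (h : StrictSigns Y) :
    WeakSigns Y :=
  ⟨fun l i j hij k m hkm => (h.1 l i j hij k m hkm).le, h.2.le⟩

theorem strictSigns_mul_iff {g : Fin 2 → Matrix (Fin 2) (Fin 2) ℝ} (hg : ∀ l, (g l).det ≠ 0)
    (Y : Fin 2 → Matrix (Fin 2) (Fin 4) ℝ) :
    StrictSigns (fun l => g l * Y l) ↔ StrictSigns Y := by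
  have hpos (l : Fin 2) : 0 < (g l).det ^ 2 := by have := hg l; positivity
  have h1 (l : Fin 2) (i j k m : Fin 4) : minor (g l * Y l) i j * minor (g l * Y l) k m =
      (g l).det ^ 2 * (minor (Y l) i j * minor (Y l) k m) := by
    simp only [minor_mul]; ring
  have h2 : minor (g 0 * Y 0) 0 2 * minor (g 1 * Y 1) 0 2 * stack (g 0 * Y 0) (g 1 * Y 1) =
      (g 0).det ^ 2 * (g 1).det ^ 2 *
        (minor (Y 0) 0 2 * minor (Y 1) 0 2 * stack (Y 0) (Y 1)) := by
    simp only [minor_mul, stack_mul_mul]; ring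
  simp only [StrictSigns, h1, h2, mul_pos_iff_of_pos_left (hpos _),
    mul_pos_iff_of_pos_left (mul_pos (hpos 0) (hpos 1))]

theorem strictSigns_of_pos {Y : Fin 2 → Matrix (Fin 2) (Fin 4) ℝ}
    (h : ∀ l i j, i < j → 0 < minor (Y l) i j) (hs : 0 < stack (Y 0) (Y 1)) : StrictSigns Y :=
  ⟨fun l i j hij k m hkm => mul_pos (h l i j hij) (h l k m hkm),
    mul_pos (mul_pos (h 0 0 2 (by decide)) (h 1 0 2 (by decide))) hs⟩

/-- The image of the two-loop conditions in the chart. -/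
def positiveRegion : Set (Fin 2 → Fin 4 → ℝ) :=
  {u | (∀ l k, 0 < u l k) ∧ pairing (u 0 - u 1) < 0}

theorem minor_chart_zero_two (u : Fin 4 → ℝ) : minor (chart u) 0 2 = 1 := by
  simp [minor, chart]

theorem strictSigns_chart_iff (u : Fin 2 → Fin 4 → ℝ) :
    StrictSigns (fun l => chart (u l)) ↔ u ∈ positiveRegion := by
  constructor
  · rintro ⟨h1, h2⟩
    refine ⟨fun l => (minor_chart_pos_iff (u l)).1 fun i j hij => ?_, ?_⟩
    · simpa [minor_chart_zero_two] using h1 l i j hij 0 2 (by decide)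
    · simpa [minor_chart_zero_two, stack_chart] using h2
  · rintro ⟨h1, h2⟩
    exact strictSigns_of_pos (fun l => (minor_chart_pos_iff (u l)).2 (h1 l))
      (by simpa [stack_chart] using h2)

/-- The rows of the matrices `X l`, written in the basis formed by the rows of `Z`. -/
def inBasis (Z : Matrix (Fin 4) (Fin 4) ℝ) (X : Fin 2 → FullRank 2 4) :
    Fin 2 → Matrix (Fin 2) (Fin 4) ℝ :=
  fun l => (X l).1 * Z⁻¹

theorem continuous_inBasis (Z : Matrix (Fin 4) (Fin 4) ℝ) : Continuous (inBasis Z) :=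
  continuous_pi fun l =>
    (continuous_subtype_val.comp (continuous_apply l)).matrix_mul continuous_const

theorem linearIndependent_row_mul_right {k n : ℕ} {M : Matrix (Fin k) (Fin n) ℝ}
    {Z : Matrix (Fin n) (Fin n) ℝ} (hM : LinearIndependent ℝ M.row) (hZ : IsUnit Z) :
    LinearIndependent ℝ (M * Z).row := by
  rw [← Matrix.vecMul_injective_iff] at hM ⊢
  intro v w h
  simp only [← Matrix.vecMul_vecMul] at h
  exact hM (Matrix.vecMul_injective_of_isUnit hZ h)

theorem linearIndependent_row_chart (u : Fin 4 → ℝ) : LinearIndependent ℝ (chart u).row := by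
  rw [← Matrix.vecMul_injective_iff]
  intro v w h
  have h0 := congrFun h 0
  have h2 := congrFun h 2
  simp [Matrix.vecMul, dotProduct, chart] at h0 h2
  ext i
  fin_cases i
  exacts [h0, h2]

theorem isUnit_of_det_pos {Z : Matrix (Fin 4) (Fin 4) ℝ} (hZ : 0 < Z.det) : IsUnit Z :=
  (Matrix.isUnit_iff_isUnit_det Z).2 hZ.ne'.isUnit

/-- The representatives given by the chart, in the basis formed by the rows of `Z`. -/
def chartRep {Z : Matrix (Fin 4) (Fin 4) ℝ} (hZ : 0 < Z.det)
    (u : Fin 2 → Fin 4 → ℝ) : Fin 2 → FullRank 2 4 := fun l =>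
  ⟨chart (u l) * Z,
    linearIndependent_row_mul_right (linearIndependent_row_chart (u l)) (isUnit_of_det_pos hZ)⟩

/-- The pair of planes with given chart coordinates. -/
def chartPoint {Z : Matrix (Fin 4) (Fin 4) ℝ} (hZ : 0 < Z.det)
    (u : Fin 2 → Fin 4 → ℝ) : Fin 2 → Gr 2 4 :=
  Pi.map (fun _ => rowSpace) (chartRep hZ u)

theorem inBasis_chartRep {Z : Matrix (Fin 4) (Fin 4) ℝ} (hZ : 0 < Z.det)
    (u : Fin 2 → Fin 4 → ℝ) :
    inBasis Z (chartRep hZ u) = fun l => chart (u l) := by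
  funext l
  exact Matrix.mul_nonsing_inv_cancel_right _ _ hZ.ne'.isUnit

theorem inBasis_mul {Z : Matrix (Fin 4) (Fin 4) ℝ} (hZ : 0 < Z.det)
    (X : Fin 2 → FullRank 2 4) (l : Fin 2) : inBasis Z X l * Z = (X l).1 :=
  Matrix.nonsing_inv_mul_cancel_right _ _ hZ.ne'.isUnit

theorem exists_inBasis_eq_mul (Z : Matrix (Fin 4) (Fin 4) ℝ) {X X' : Fin 2 → FullRank 2 4}
    (h : ∀ l, rowSpace (X l) = rowSpace (X' l)) :
    ∃ g : Fin 2 → Matrix (Fin 2) (Fin 2) ℝ, (∀ l, (g l).det ≠ 0) ∧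
      inBasis Z X = fun l => g l * inBasis Z X' l := by
  choose g hg using fun l => rowSpace_eq_iff.1 (h l)
  refine ⟨fun l => (g l).1, fun l => ((Matrix.isUnit_iff_isUnit_det _).1 (g l).isUnit).ne_zero, ?_⟩
  funext l
  simp only [inBasis]
  rw [← Matrix.mul_assoc]
  exact congrArg (fun M : FullRank 2 4 => M.1 * Z⁻¹) (hg l)

theorem chartPoint_coord {Z : Matrix (Fin 4) (Fin 4) ℝ} (hZ : 0 < Z.det)
    {X : Fin 2 → FullRank 2 4} (h : ∀ l, minor (inBasis Z X l) 0 2 ≠ 0) :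
    chartPoint hZ (fun l => coord (inBasis Z X l)) = Pi.map (fun _ => rowSpace) X := by
  funext l
  obtain ⟨g, hg, hY⟩ := exists_mul_chart_coord (h l)
  have hu : IsUnit g := (Matrix.isUnit_iff_isUnit_det g).2 (hg ▸ (h l).isUnit)
  refine (rowSpace_eq_iff.2 ⟨hu.unit, Subtype.ext ?_⟩).symm
  change (X l).1 = g * (chart (coord (inBasis Z X l)) * Z)
  rw [← Matrix.mul_assoc, ← hY, inBasis_mul hZ]

theorem StrictSigns.minor_ne_zero {Y : Fin 2 → Matrix (Fin 2) (Fin 4) ℝ} (h : StrictSigns Y)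
    (l : Fin 2) : minor (Y l) 0 2 ≠ 0 :=
  left_ne_zero_of_mul (h.1 l 0 2 (by decide) 0 2 (by decide)).ne'

theorem StrictSigns.coord_mem {Y : Fin 2 → Matrix (Fin 2) (Fin 4) ℝ} (h : StrictSigns Y) :
    (fun l => coord (Y l)) ∈ positiveRegion := by
  choose g hg hY using fun l => exists_mul_chart_coord (h.minor_ne_zero l)
  have hdet (l : Fin 2) : (g l).det ≠ 0 := by rw [hg l]; exact h.minor_ne_zero l
  rw [← strictSigns_chart_iff, ← strictSigns_mul_iff hdet]
  rw [funext hY] at h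
  exact h

theorem chartPoint_mem_openConditions {Z : Matrix (Fin 4) (Fin 4) ℝ} (hZ : 0 < Z.det)
    {u : Fin 2 → Fin 4 → ℝ} (hu : u ∈ positiveRegion) :
    chartPoint hZ u ∈ openConditions 2 Z := by
  refine ⟨chartRep hZ u, fun l => rfl, fun l => ?_, fun l l' hl => ?_⟩
  · exact (oneLoop_mul_iff hZ _).2 ((minor_chart_pos_iff _).2 (hu.1 l))
  · obtain ⟨rfl, rfl⟩ : l = 0 ∧ l' = 1 := by omega
    change 0 < stack (chart (u 0) * Z) (chart (u 1) * Z)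
    rw [stack_mul, stack_chart]
    exact mul_pos (neg_pos.2 hu.2) hZ

/-- Membership in the two-loop conditions can be tested on any representatives. -/
theorem map_rowSpace_mem_openConditions_iff {Z : Matrix (Fin 4) (Fin 4) ℝ} (hZ : 0 < Z.det)
    (X : Fin 2 → FullRank 2 4) :
    Pi.map (fun _ => rowSpace) X ∈ openConditions 2 Z ↔ StrictSigns (inBasis Z X) := by
  constructor
  · rintro ⟨X', hrow, hloop, hstack⟩
    obtain ⟨g, hg, hX⟩ := exists_inBasis_eq_mul Z fun l => (hrow l).symm
    rw [hX, strictSigns_mul_iff hg]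
    refine strictSigns_of_pos (fun l => (oneLoop_mul_iff hZ _).1 ?_) ?_
    · rw [inBasis_mul hZ]
      exact hloop l
    · refine pos_of_mul_pos_left (b := Z.det) ?_ hZ.le
      rw [← stack_mul, inBasis_mul hZ, inBasis_mul hZ]
      exact hstack 0 1 (by decide)
  · intro h
    rw [← chartPoint_coord hZ h.minor_ne_zero]
    exact chartPoint_mem_openConditions hZ h.coord_mem

theorem continuous_minor (i j : Fin 4) : Continuous fun Y => minor Y i j := by
  unfold minor
  fun_prop

theorem isOpen_setOf_strictSigns : IsOpen {Y | StrictSigns Y} := by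
  simp only [StrictSigns, Set.ofPred_and, Set.ofPred_forall, stack_eq, minor]
  refine .inter ?_ (isOpen_lt (by fun_prop) (by fun_prop))
  exact isOpen_iInter_of_finite fun l => isOpen_iInter_of_finite fun i =>
    isOpen_iInter_of_finite fun j => isOpen_iInter_of_finite fun _ =>
    isOpen_iInter_of_finite fun k => isOpen_iInter_of_finite fun m =>
    isOpen_iInter_of_finite fun _ => isOpen_lt (by fun_prop) (by fun_prop)

theorem isClosed_setOf_weakSigns : IsClosed {Y | WeakSigns Y} := by
  simp only [WeakSigns, Set.ofPred_and, Set.ofPred_forall, stack_eq, minor]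
  refine .inter ?_ (isClosed_le (by fun_prop) (by fun_prop))
  exact isClosed_iInter fun l => isClosed_iInter fun i =>
    isClosed_iInter fun j => isClosed_iInter fun _ =>
    isClosed_iInter fun k => isClosed_iInter fun m =>
    isClosed_iInter fun _ => isClosed_le (by fun_prop) (by fun_prop)

theorem isOpenQuotientMap_map_rowSpace :
    IsOpenQuotientMap (Pi.map (fun _ => rowSpace) : (Fin 2 → FullRank 2 4) → Fin 2 → Gr 2 4) :=
  .piMap fun _ => isOpenQuotientMap_rowSpace

theorem isOpen_openConditions {Z : Matrix (Fin 4) (Fin 4) ℝ} (hZ : 0 < Z.det)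
: IsOpen (openConditions 2 Z) := by
  rw [← isOpenQuotientMap_map_rowSpace.isQuotientMap.isOpen_preimage]
  convert isOpen_setOf_strictSigns.preimage (continuous_inBasis Z) using 1
  ext X
  exact map_rowSpace_mem_openConditions_iff hZ X

/-- The weak conditions are closed, and preimages under the open row space map commute with
closures. -/
theorem weakSigns_of_mem_amplituhedron {Z : Matrix (Fin 4) (Fin 4) ℝ} (hZ : 0 < Z.det)
    {X : Fin 2 → FullRank 2 4}
    (h : Pi.map (fun _ => rowSpace) X ∈ amplituhedron 2 Z) : WeakSigns (inBasis Z X) := by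
  have hq := isOpenQuotientMap_map_rowSpace
  have hX : X ∈ closure (Pi.map (fun _ => rowSpace) ⁻¹' openConditions 2 Z) := by
    rw [← hq.isOpenMap.preimage_closure_eq_closure_preimage hq.continuous]
    exact h
  refine closure_minimal (fun X' hX' => ?_)
    (isClosed_setOf_weakSigns.preimage (continuous_inBasis Z)) hX
  exact ((map_rowSpace_mem_openConditions_iff hZ X').1 hX').weakSigns

/-! ### The interior of the Amplituhedron -/

/-- If the second differences of `f` at `x` in the direction `e` are positive, then `f` takes
positive values arbitrarily close to `x`. -/
theorem exists_mem_nhds_pos {V : Type*} [AddCommGroup V] [Module ℝ V] [TopologicalSpace V]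
    [ContinuousAdd V] [ContinuousSMul ℝ V] {f : V → ℝ} {x e : V}
    (h : ∀ t : ℝ, t ≠ 0 → 0 < f (x + t • e) + f (x + (-t) • e)) {N : Set V} (hN : N ∈ 𝓝 x) :
    ∃ y ∈ N, 0 < f y := by
  have hc : Continuous fun t : ℝ => x + t • e := by fun_prop
  have hc' : Continuous fun t : ℝ => x + (-t) • e := by fun_prop
  have h1 : ∀ᶠ t in 𝓝 (0 : ℝ), x + t • e ∈ N := hc.tendsto' 0 x (by simp) hN
  have h2 : ∀ᶠ t in 𝓝 (0 : ℝ), x + (-t) • e ∈ N := hc'.tendsto' 0 x (by simp) hN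
  obtain ⟨t, ⟨ht1, ht2⟩, ht⟩ :=
    (((h1.and h2).filter_mono nhdsWithin_le_nhds).and
      (self_mem_nhdsWithin : {(0 : ℝ)}ᶜ ∈ 𝓝[≠] 0)).exists
  by_contra! hN'
  have := h t ht
  linarith [hN' _ ht1, hN' _ ht2]

theorem isOpen_setOf_linearIndependent_row (k n : ℕ) :
    IsOpen {M : Matrix (Fin k) (Fin n) ℝ | LinearIndependent ℝ M.row} :=
  isOpen_setOfPred_linearIndependent (𝕜 := ℝ) (E := Fin n → ℝ) (ι := Fin k)

/-- Perturbing one of the two matrices inside an open set of pairs of full-rank matrices. -/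
theorem setOf_update_mem_nhds {U : Set (Fin 2 → FullRank 2 4)} (hU : IsOpen U)
    {X : Fin 2 → FullRank 2 4} (hX : X ∈ U) (l : Fin 2) :
    {M | ∃ h : LinearIndependent ℝ M.row, Function.update X l ⟨M, h⟩ ∈ U} ∈ 𝓝 (X l).1 := by
  have hopen : IsOpen (Function.update X l ⁻¹' U) :=
    hU.preimage (continuous_const.update l continuous_id)
  have himage := (isOpen_setOf_linearIndependent_row 2 4).isOpenEmbedding_subtypeVal.isOpenMap
    _ hopen
  refine Filter.mem_of_superset (himage.mem_nhds ⟨X l, by simpa using hX, rfl⟩) ?_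
  rintro _ ⟨M, hM, rfl⟩
  exact ⟨M.2, hM⟩

theorem inBasis_update (Z : Matrix (Fin 4) (Fin 4) ℝ) (X : Fin 2 → FullRank 2 4) (l : Fin 2)
    (M : FullRank 2 4) :
    inBasis Z (Function.update X l M) = Function.update (inBasis Z X) l (M.1 * Z⁻¹) := by
  funext k
  by_cases h : k = l
  · subst h; simp [inBasis]
  · simp [inBasis, h]

theorem add_smul_mul_inv {Z : Matrix (Fin 4) (Fin 4) ℝ} (hZ : 0 < Z.det)
    (M E : Matrix (Fin 2) (Fin 4) ℝ) (t : ℝ) :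
    (M + t • (E * Z)) * Z⁻¹ = M * Z⁻¹ + t • E := by
  rw [Matrix.add_mul, Matrix.smul_mul, Matrix.mul_nonsing_inv_cancel_right _ _ hZ.ne'.isUnit]

/-- The parallelogram law for a minor, as a quadratic form in the matrix. -/
theorem minor_add_smul (Y E : Matrix (Fin 2) (Fin 4) ℝ) (t : ℝ) (i j : Fin 4) :
    minor (Y + t • E) i j + minor (Y + (-t) • E) i j =
      2 * minor Y i j + 2 * t ^ 2 * minor E i j := by
  simp only [minor, Matrix.add_apply, Matrix.smul_apply, smul_eq_mul]
  ring

theorem stack_add_smul (Y E Y' : Matrix (Fin 2) (Fin 4) ℝ) (t : ℝ) :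
    stack (Y + t • E) Y' + stack (Y + (-t) • E) Y' = 2 * stack Y Y' + 2 * t ^ 2 * stack E Y' := by
  simp only [stack_eq]
  linear_combination minor Y' 2 3 * minor_add_smul Y E t 0 1
    - minor Y' 1 3 * minor_add_smul Y E t 0 2 + minor Y' 1 2 * minor_add_smul Y E t 0 3
    + minor Y' 0 3 * minor_add_smul Y E t 1 2 - minor Y' 0 2 * minor_add_smul Y E t 1 3
    + minor Y' 0 1 * minor_add_smul Y E t 2 3

section Interior

variable {Z : Matrix (Fin 4) (Fin 4) ℝ} {U : Set (Fin 2 → FullRank 2 4)}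
  {X : Fin 2 → FullRank 2 4}

/-- If the weak conditions hold on an open set, no minor vanishes on it: near a zero, the minor
could be given the sign opposite to that of a nonvanishing minor of the same matrix. -/
theorem minor_ne_zero_of_weakSigns (hZ : 0 < Z.det) (hU : IsOpen U)
    (hweak : ∀ X ∈ U, WeakSigns (inBasis Z X)) (hX : X ∈ U) (l : Fin 2) {i j : Fin 4}
    (hij : i < j) : minor (inBasis Z X l) i j ≠ 0 := by
  intro hzero
  have hind : LinearIndependent ℝ (inBasis Z X l).row :=
    linearIndependent_row_mul_right (X l).2 (Matrix.isUnit_nonsing_inv_iff.2 (isUnit_of_det_pos hZ))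
  obtain ⟨k, m, hkm, hc⟩ := exists_minor_ne_zero hind
  set c := minor (inBasis Z X l) k m
  -- A direction in which the quadratic form `minor · i j` has the sign opposite to `c`.
  let E : Matrix (Fin 2) (Fin 4) ℝ := Matrix.of ![Pi.single i (-c), Pi.single j 1]
  have hE : minor E i j = -c := by simp [E, minor, hij.ne, hij.ne']
  have hcont : Continuous fun M : Matrix (Fin 2) (Fin 4) ℝ => c * minor (M * Z⁻¹) k m :=
    continuous_const.mul ((continuous_minor k m).comp
      (continuous_id.matrix_mul continuous_const))
  have hN := Filter.inter_mem (setOf_update_mem_nhds hU hX l)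
    ((isOpen_lt continuous_const hcont).mem_nhds
      (show 0 < c * minor ((X l).1 * Z⁻¹) k m from mul_self_pos.2 hc))
  obtain ⟨M, ⟨⟨hM, hMU⟩, hMk⟩, hMpos⟩ := exists_mem_nhds_pos
    (f := fun M => -c * minor (M * Z⁻¹) i j) (x := (X l).1) (e := E * Z) (fun t ht => by
      have hpar := minor_add_smul ((X l).1 * Z⁻¹) E t i j
      have hz : minor ((X l).1 * Z⁻¹) i j = 0 := hzero
      rw [add_smul_mul_inv hZ, add_smul_mul_inv hZ, ← mul_add, hpar, hz, hE]
      have : 0 < 2 * (t ^ 2 * c ^ 2) := by positivity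
      linarith) hN
  have hw := (hweak _ hMU).1 l i j hij k m hkm
  rw [inBasis_update, Function.update_self] at hw
  have hMk' : 0 < c * minor (M * Z⁻¹) k m := hMk
  have hprod := mul_pos hMpos hMk'
  have : 0 ≤ c ^ 2 * (minor (M * Z⁻¹) i j * minor (M * Z⁻¹) k m) := by positivity
  linarith

/-- If the weak conditions hold on an open set, the stacked determinant does not vanish on it: near
a zero, perturbing the first matrix would give it the forbidden sign. -/
theorem stack_ne_zero_of_weakSigns (hZ : 0 < Z.det) (hU : IsOpen U)
    (hweak : ∀ X ∈ U, WeakSigns (inBasis Z X)) (hX : X ∈ U) :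
    stack (inBasis Z X 0) (inBasis Z X 1) ≠ 0 := by
  intro hzero
  have hp := minor_ne_zero_of_weakSigns hZ hU hweak hX 0 (i := 0) (j := 2) (by decide)
  have hq := minor_ne_zero_of_weakSigns hZ hU hweak hX 1 (i := 0) (j := 2) (by decide)
  set p := minor (inBasis Z X 0) 0 2
  set q := minor (inBasis Z X 1) 0 2 with hq_def
  -- The only nonzero minor of `E` is the one paired with `q` in the expansion of the stack.
  let E : Matrix (Fin 2) (Fin 4) ℝ := Matrix.of ![Pi.single 1 p, Pi.single 3 1]
  have hE : stack E (inBasis Z X 1) = -(p * q) := by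
    rw [stack_eq, ← hq_def]; simp [E, minor]
  -- Stay near `X 0`, so that the sign of its minor in the columns `0, 2` is kept.
  have hcont : Continuous fun M : Matrix (Fin 2) (Fin 4) ℝ => p * minor (M * Z⁻¹) 0 2 :=
    continuous_const.mul ((continuous_minor 0 2).comp
      (continuous_id.matrix_mul continuous_const))
  have hN := Filter.inter_mem (setOf_update_mem_nhds hU hX 0)
    ((isOpen_lt continuous_const hcont).mem_nhds
      (show 0 < p * minor ((X 0).1 * Z⁻¹) 0 2 from mul_self_pos.2 hp))
  obtain ⟨M, ⟨⟨hM, hMU⟩, hMk⟩, hMpos⟩ := exists_mem_nhds_pos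
    (f := fun M => -(p * q) * stack (M * Z⁻¹) (inBasis Z X 1)) (x := (X 0).1) (e := E * Z)
    (fun t ht => by
      have hpar := stack_add_smul ((X 0).1 * Z⁻¹) E (inBasis Z X 1) t
      have hz : stack ((X 0).1 * Z⁻¹) (inBasis Z X 1) = 0 := hzero
      rw [add_smul_mul_inv hZ, add_smul_mul_inv hZ, ← mul_add, hpar, hz, hE]
      have : 0 < 2 * (t ^ 2 * (p * q) ^ 2) := by positivity
      linarith) hN
  have hw := (hweak _ hMU).2
  rw [inBasis_update, Function.update_self, Function.update_of_ne (by decide), ← hq_def] at hw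
  have hMk' : 0 < p * minor (M * Z⁻¹) 0 2 := hMk
  have hprod : p * minor (M * Z⁻¹) 0 2 * (q * stack (M * Z⁻¹) (inBasis Z X 1)) ^ 2 ≤ 0 := by
    have := mul_nonneg hMpos.le hw
    linarith
  have hne : q * stack (M * Z⁻¹) (inBasis Z X 1) ≠ 0 := by
    intro h0
    rw [neg_mul, mul_assoc, h0] at hMpos
    simp at hMpos
  have : 0 < p * minor (M * Z⁻¹) 0 2 * (q * stack (M * Z⁻¹) (inBasis Z X 1)) ^ 2 := by positivity
  linarith

end Interior

/-- The interior of the closure adds nothing: a minor or stacked determinant that vanishes at a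
point changes sign near it. -/
theorem interior_amplituhedron {Z : Matrix (Fin 4) (Fin 4) ℝ} (hZ : 0 < Z.det) :
    interior (amplituhedron 2 Z) = openConditions 2 Z := by
  refine Set.Subset.antisymm (fun P hP => ?_)
    (interior_maximal subset_closure (isOpen_openConditions hZ))
  have hq := isOpenQuotientMap_map_rowSpace
  obtain ⟨X, rfl⟩ := hq.surjective P
  have hU : IsOpen (Pi.map (fun _ => rowSpace) ⁻¹' interior (amplituhedron 2 Z) :
      Set (Fin 2 → FullRank 2 4)) := isOpen_interior.preimage hq.continuous
  have hweak : ∀ X ∈ (Pi.map (fun _ => rowSpace) ⁻¹' interior (amplituhedron 2 Z) :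
      Set (Fin 2 → FullRank 2 4)), WeakSigns (inBasis Z X) := fun X hX =>
    weakSigns_of_mem_amplituhedron hZ (interior_subset hX)
  rw [map_rowSpace_mem_openConditions_iff hZ]
  have hminor (l : Fin 2) {i j : Fin 4} (hij : i < j) :=
    minor_ne_zero_of_weakSigns hZ hU hweak hP l hij
  refine ⟨fun l i j hij k m hkm => ?_, ?_⟩
  · exact ((hweak X hP).1 l i j hij k m hkm).lt_of_ne'
      (mul_ne_zero (hminor l hij) (hminor l hkm))
  · exact (hweak X hP).2.lt_of_ne' (mul_ne_zero
      (mul_ne_zero (hminor 0 (by decide)) (hminor 1 (by decide)))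
      (stack_ne_zero_of_weakSigns hZ hU hweak hP))

/-- The chart coordinates of a pair of planes, in the basis formed by the rows of `Z`; they are
meaningful where the minors in the columns `0` and `2` do not vanish. -/
def pointCoord (Z : Matrix (Fin 4) (Fin 4) ℝ) (P : Fin 2 → Gr 2 4) : Fin 2 → Fin 4 → ℝ :=
  fun l => coord (inBasis Z (Function.surjInv isOpenQuotientMap_map_rowSpace.surjective P) l)

theorem pointCoord_map_rowSpace (Z : Matrix (Fin 4) (Fin 4) ℝ) (X : Fin 2 → FullRank 2 4) :
    pointCoord Z (Pi.map (fun _ => rowSpace) X) = fun l => coord (inBasis Z X l) := by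
  have h := Function.surjInv_eq isOpenQuotientMap_map_rowSpace.surjective
    (Pi.map (fun _ => rowSpace) X)
  obtain ⟨g, hg, hX⟩ := exists_inBasis_eq_mul Z fun l => congrFun h l
  funext l
  rw [pointCoord, hX, coord_mul (hg l)]

theorem pointCoord_chartPoint {Z : Matrix (Fin 4) (Fin 4) ℝ} (hZ : 0 < Z.det)
    (u : Fin 2 → Fin 4 → ℝ) : pointCoord Z (chartPoint hZ u) = u := by
  rw [chartPoint, pointCoord_map_rowSpace, inBasis_chartRep]
  exact funext fun l => coord_chart (u l)

theorem continuousOn_pointCoord {Z : Matrix (Fin 4) (Fin 4) ℝ} (hZ : 0 < Z.det) :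
    ContinuousOn (pointCoord Z) (openConditions 2 Z) := by
  intro P hP
  have hq := isOpenQuotientMap_map_rowSpace
  obtain ⟨X, rfl⟩ := hq.surjective P
  refine ContinuousAt.continuousWithinAt (hq.continuousAt_comp_iff.1 ?_)
  have hX := (map_rowSpace_mem_openConditions_iff hZ X).1 hP
  have heq : pointCoord Z ∘ Pi.map (fun _ => rowSpace) =
      fun X l => coord (inBasis Z X l) := funext fun X => pointCoord_map_rowSpace Z X
  rw [heq]
  refine continuousAt_pi.2 fun l => continuousAt_pi.2 fun k => ?_
  have hm (i j : Fin 4) : ContinuousAt (fun X => minor (inBasis Z X l) i j) X :=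
    ((continuous_minor i j).comp
      ((continuous_apply l).comp (continuous_inBasis Z))).continuousAt
  have hne := hX.minor_ne_zero l
  fin_cases k <;> exact (hm _ _).div (hm _ _) hne

theorem continuous_chartPoint {Z : Matrix (Fin 4) (Fin 4) ℝ} (hZ : 0 < Z.det) :
    Continuous (chartPoint hZ) := by
  refine isOpenQuotientMap_map_rowSpace.continuous.comp (continuous_pi fun l => ?_)
  refine Continuous.subtype_mk (Continuous.matrix_mul ?_ continuous_const) _
  refine continuous_matrix fun i j => ?_
  fin_cases i <;> fin_cases j <;> simp [chart] <;> fun_prop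

theorem pointCoord_mem {Z : Matrix (Fin 4) (Fin 4) ℝ} (hZ : 0 < Z.det) {P : Fin 2 → Gr 2 4}
    (hP : P ∈ openConditions 2 Z) :
    pointCoord Z P ∈ positiveRegion ∧ chartPoint hZ (pointCoord Z P) = P := by
  obtain ⟨X, rfl⟩ := isOpenQuotientMap_map_rowSpace.surjective P
  have hX := (map_rowSpace_mem_openConditions_iff hZ X).1 hP
  rw [pointCoord_map_rowSpace]
  exact ⟨hX.coord_mem, chartPoint_coord hZ hX.minor_ne_zero⟩

/-- The chart identifies the pairs of planes satisfying the two-loop conditions with the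
semialgebraic region `positiveRegion`. -/
def openConditionsHomeomorph {Z : Matrix (Fin 4) (Fin 4) ℝ} (hZ : 0 < Z.det) :
    openConditions 2 Z ≃ₜ positiveRegion where
  toFun P := ⟨pointCoord Z P, (pointCoord_mem hZ P.2).1⟩
  invFun u := ⟨chartPoint hZ u, chartPoint_mem_openConditions hZ u.2⟩
  left_inv P := Subtype.ext (pointCoord_mem hZ P.2).2
  right_inv u := Subtype.ext (pointCoord_chartPoint hZ u)
  continuous_toFun := (continuousOn_iff_continuous_domRestrict.1
    (continuousOn_pointCoord hZ)).subtype_mk _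
  continuous_invFun := ((continuous_chartPoint hZ).comp continuous_subtype_val).subtype_mk _

/-! ### Homotopy type of the region in the chart -/

/-- The projection of the difference `u 0 - u 1` onto a maximal negative definite subspace of
`pairing`, identified with the complex plane. -/
def negPart (u : Fin 2 → Fin 4 → ℝ) : ℂ :=
  ⟨(u 0 - u 1) 3 - (u 0 - u 1) 0, (u 0 - u 1) 2 - (u 0 - u 1) 1⟩

/-- The negative definite vector with given projection. -/
def negVector (z : ℂ) : Fin 4 → ℝ := ![-z.re / 2, -z.im / 2, z.im / 2, z.re / 2]

/-- A pair of positive vectors whose difference is `negVector z`. -/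
def negLift (z : ℂ) : Fin 2 → Fin 4 → ℝ :=
  ![fun k => max (negVector z k) 0 + 1, fun k => max (-negVector z k) 0 + 1]

theorem negLift_sub (z : ℂ) : negLift z 0 - negLift z 1 = negVector z := by
  ext k
  have h : max (negVector z k) 0 - max (-negVector z k) 0 = negVector z k :=
    max_zero_sub_eq_self _
  simp only [negLift, Matrix.cons_val_zero, Matrix.cons_val_one, Pi.sub_apply]
  linarith

theorem negLift_pos (z : ℂ) (l : Fin 2) (k : Fin 4) : 0 < negLift z l k := by
  fin_cases l <;> simp [negLift] <;> positivity

theorem negPart_negLift (z : ℂ) : negPart (negLift z) = z := by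
  rw [negPart, negLift_sub]
  apply Complex.ext <;> simp [negVector] <;> ring

theorem pairing_negVector_neg {z : ℂ} (hz : z ≠ 0) : pairing (negVector z) < 0 := by
  have h := Complex.normSq_pos.2 hz
  rw [Complex.normSq_apply] at h
  simp [pairing, negVector]
  linarith

theorem negLift_mem {z : ℂ} (hz : z ≠ 0) : negLift z ∈ positiveRegion :=
  ⟨negLift_pos z, by rw [negLift_sub]; exact pairing_negVector_neg hz⟩

theorem negPart_ne_zero {u : Fin 2 → Fin 4 → ℝ} (hu : u ∈ positiveRegion) : negPart u ≠ 0 := by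
  intro h
  have h1 := congrArg Complex.re h
  have h2 := congrArg Complex.im h
  have h3 := hu.2
  simp only [negPart, Complex.zero_re, Complex.zero_im, pairing] at h1 h2 h3
  rw [sub_eq_zero.1 h1, sub_eq_zero.1 h2] at h3
  linarith [mul_self_nonneg ((u 0 - u 1) 0), mul_self_nonneg ((u 0 - u 1) 1)]

/-- Along the segment from `u` to `negLift (negPart u)` the negative definite part of the
difference is constant and its positive definite part shrinks. -/
theorem segment_mem {u : Fin 2 → Fin 4 → ℝ} (hu : u ∈ positiveRegion) {t : ℝ} (ht0 : 0 ≤ t)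
    (ht1 : t ≤ 1) : (1 - t) • u + t • negLift (negPart u) ∈ positiveRegion := by
  refine ⟨fun l k => ?_, ?_⟩
  · have h1 := hu.1 l k
    have h2 := negLift_pos (negPart u) l k
    simp only [Pi.add_apply, Pi.smul_apply, smul_eq_mul]
    rcases ht0.eq_or_lt with rfl | ht
    · simpa using h1
    · have := mul_nonneg (sub_nonneg.2 ht1) h1.le
      have := mul_pos ht h2
      linarith
  · have hdiff : ((1 - t) • u + t • negLift (negPart u)) 0 -
        ((1 - t) • u + t • negLift (negPart u)) 1 =
        (1 - t) • (u 0 - u 1) + t • negVector (negPart u) := by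
      rw [← negLift_sub]
      simp only [Pi.add_apply, Pi.smul_apply, smul_sub]
      abel
    rw [hdiff]
    have h := hu.2
    simp only [negPart]
    generalize u 0 - u 1 = w at h ⊢
    simp [pairing, negVector] at h ⊢
    -- In `4 * pairing w = (w 0 + w 3) ^ 2 + (w 1 + w 2) ^ 2 - (w 3 - w 0) ^ 2 - (w 2 - w 1) ^ 2`
    -- the first two squares are scaled by `(1 - t) ^ 2` and the last two are unchanged.
    have key : 0 ≤ (1 - (1 - t) ^ 2) * ((w 0 + w 3) ^ 2 + (w 1 + w 2) ^ 2) := by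
      have : 0 ≤ 1 - (1 - t) ^ 2 := by nlinarith
      positivity
    linarith

theorem continuous_negPart : Continuous negPart := by
  have h : negPart = fun u => (((u 0 3 - u 1 3) - (u 0 0 - u 1 0) : ℝ) : ℂ) +
      (((u 0 2 - u 1 2) - (u 0 1 - u 1 1) : ℝ) : ℂ) * Complex.I := by
    funext u
    apply Complex.ext <;> simp [negPart]
  rw [h]
  fun_prop

theorem continuous_negLift : Continuous negLift := by
  have hv (k : Fin 4) : Continuous fun z => negVector z k := by
    fin_cases k <;> simp [negVector] <;> fun_prop
  refine continuous_pi fun l => continuous_pi fun k => ?_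
  have := hv k
  fin_cases l <;> simp [negLift] <;> fun_prop

/-- The region in the chart is homotopy equivalent to the punctured plane. -/
def positiveRegionHomotopyEquiv :
    ContinuousMap.HomotopyEquiv positiveRegion {z : ℂ // z ≠ 0} where
  toFun := ⟨fun u => ⟨negPart u, negPart_ne_zero u.2⟩,
    (continuous_negPart.comp continuous_subtype_val).subtype_mk _⟩
  invFun := ⟨fun z => ⟨negLift z, negLift_mem z.2⟩,
    (continuous_negLift.comp continuous_subtype_val).subtype_mk _⟩
  left_inv := by
    refine ContinuousMap.Homotopic.symm ⟨⟨⟨fun p =>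
      ⟨(1 - (p.1 : ℝ)) • (p.2 : Fin 2 → Fin 4 → ℝ) + (p.1 : ℝ) • negLift (negPart p.2),
        segment_mem p.2.2 p.1.2.1 p.1.2.2⟩, ?_⟩, fun u => ?_, fun u => ?_⟩⟩
    · have h1 := continuous_negLift
      have h2 := continuous_negPart
      exact Continuous.subtype_mk (by fun_prop) _
    · exact Subtype.ext (by simp)
    · exact Subtype.ext (by simp)
  right_inv := by
    convert ContinuousMap.Homotopic.refl _
    ext z : 2
    exact (negPart_negLift z).symm

end LoopAmplituhedron

end

theorem theorem4p1 (Z : Matrix (Fin 4) (Fin 4) ℝ) (hZ : 0 < Z.det) :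
    IsConnected (interior (LoopAmplituhedron.amplituhedron 2 Z)) ∧
      ∀ x : interior (LoopAmplituhedron.amplituhedron 2 Z),
        Nonempty (FundamentalGroup (interior (LoopAmplituhedron.amplituhedron 2 Z)) x ≃*
          FreeGroup Unit) := by
  have e : ContinuousMap.HomotopyEquiv (interior (LoopAmplituhedron.amplituhedron 2 Z))
      {z : ℂ // z ≠ 0} :=
    ((Homeomorph.setCongr (LoopAmplituhedron.interior_amplituhedron hZ)).trans
      (LoopAmplituhedron.openConditionsHomeomorph hZ)).toHomotopyEquiv.trans
      LoopAmplituhedron.positiveRegionHomotopyEquiv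
  have hC := LoopAmplituhedron.pathConnectedSpace_compl_zero
  refine ⟨?_, fun x => ?_⟩
  · have := LoopAmplituhedron.pathConnectedSpace_of_homotopyEquiv e
    exact (isPathConnected_iff_pathConnectedSpace.2 this).isConnected
  · obtain ⟨f⟩ := LoopAmplituhedron.nonempty_fundamentalGroup_mulEquiv e x
    obtain ⟨g⟩ := LoopAmplituhedron.nonempty_fundamentalGroup_compl_zero_mulEquiv (e x)
    exact ⟨f.trans g⟩
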